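/- Let $\mathcal G$ be a finite directed acyclic graph with vertex set $V$, let each $v\in V$ carry a random variable $X_v$, and let $P$ be a joint distribution of $(X_v)_{v\in V}$ that factorizes according to $\mathcal G$: with respect to a product of $\sigma$-finite reference measures it has the density $\prod_{v\in V} f_v(x_v\mid x_{\mathrm{pa}(v)})$, where $f_v$ is a conditional density of $X_v$ given the variables at the parents $\mathrm{pa}(v)$ of $v$. Let $O\subseteq V$ be the set of observed vertices; observed variables take values in countable discrete spaces, the state spaces of the other (latent) variables are arbitrary. Write $p$ for the probabilities of the observed variables under $P$. A path (a sequence of adjacent edges, traversed in either direction, without repetition of vertices) is blocked by a set $S$ if some internal vertex is a non-collider belonging to $S$, or is a collider (both adjacent edges of the path point to it) that is not an ancestor of any vertex of $S$, where every vertex counts as an ancestor and descendant of itself. Two sets of vertices are d-separated by $S$ if every path from one to the other is blocked by $S$. They are e-separated by $S$ after deletion of $D$ if they are d-separated by $S$ in the induced subgraph of $\mathcal G$ on $V\setminus D$. **Theorem.** Let $A,B,C,D\subseteq O$ be pairwise disjoint sets such that no vertex of $C$ is a descendant of a vertex of $D$, and suppose that $A$ is e-separated from $B$ by $C$ after deletion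 of $D$. Let $d$ be any fixed value of $X_D$. 1. The probabilities $p(a,b,d\mid c)$ are compatible with a distribution under which $A\perp B\mid C$: there is a probability distribution $P^*$ of the observed variables such that $X_A\perp X_B\mid X_C$ under $P^*$ and, for every value $c$ with $p(c)>0$, one has $p^*(c)>0$ and $p^*(a,b,d\mid c)=p(a,b,d\mid c)$ for all values $a,b$. 2. If in addition no vertex of $A$ is a descendant of a vertex of $D$, then the probabilities $p(b,d\mid a,c)$ are compatible with such a distribution: there is a probability distribution $P^*$ of the observed variables such that $X_A\perp X_B\mid X_C$ under $P^*$ and, for all values $a,c$ with $p(a,c)>0$, one has $p^*(a,c)>0$ and $p^*(b,d\mid a,c)=p(b,d\mid a,c)$ for all values $b$. -/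

import Mathlib

open MeasureTheory ProbabilityTheory
open scoped ENNReal

namespace ESep

/-- A directed graph is acyclic if there is no (nontrivial) directed path from a vertex to
itself. -/
def IsAcyclic {V : Type*} (G : Digraph V) : Prop :=
  ∀ v, ¬ Relation.TransGen G.Adj v v

/-- `u` is an ancestor of `w` (equivalently, `w` is a descendant of `u`) if there is a directed
path from `u` to `w`. As usual, the path of length zero is allowed. -/
def IsAncestor {V : Type*} (G : Digraph V) (u w : V) : Prop :=
  Relation.ReflTransGen G.Adj u w

/-- The induced subgraph on the vertex set `W`. -/
def induce {V : Type*} (G : Digraph V) (W : Set V) : Digraph W where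
  Adj u w := G.Adj u w

/-- The `i`-th vertex of a walk (in the undirected skeleton) is a collider if the two edges of
the walk that are adjacent to it both point towards it. Used for internal vertices only. -/
def IsCollider {V : Type*} (G : Digraph V) {a b : V}
    (p : G.toSimpleGraphInclusive.Walk a b) (i : ℕ) : Prop :=
  G.Adj (p.getVert (i - 1)) (p.getVert i) ∧ G.Adj (p.getVert (i + 1)) (p.getVert i)

/-- A path is blocked by `C` if some internal vertex is a non-collider in `C`, or a collider
which is not an ancestor of any vertex in `C`. -/
def IsBlocked {V : Type*} (G : Digraph V) (C : Set V) {a b : V}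
    (p : G.toSimpleGraphInclusive.Walk a b) : Prop :=
  ∃ i, 0 < i ∧ i < p.length ∧
    ((¬ IsCollider G p i ∧ p.getVert i ∈ C) ∨
      (IsCollider G p i ∧ ∀ c ∈ C, ¬ IsAncestor G (p.getVert i) c))

/-- `A` and `B` are d-separated by `C`: every path (without repetition of vertices, edges
traversed in either direction) from `A` to `B` is blocked by `C`. -/
def DSeparated {V : Type*} (G : Digraph V) (A B C : Set V) : Prop :=
  ∀ a ∈ A, ∀ b ∈ B, ∀ p : G.toSimpleGraphInclusive.Walk a b, p.IsPath → IsBlocked G C p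

/-- `A` and `B` are e-separated by `C` after deletion of `D`: they are d-separated by `C` in the
induced subgraph on the complement of `D`. -/
def ESeparated {V : Type*} (G : Digraph V) (A B C D : Set V) : Prop :=
  DSeparated (induce G Dᶜ) ((↑) ⁻¹' A) ((↑) ⁻¹' B) ((↑) ⁻¹' C)

/-- The factorization criterion: with respect to a product of σ-finite reference measures, `P`
has the density `∏ v, f v`, where `f v` is a conditional density of the variable at `v` given
the variables at the parents of `v`. -/
def Factorizes {V : Type*} [Fintype V] [DecidableEq V] (G : Digraph V) {X : V → Type*}
    [∀ v, MeasurableSpace (X v)] (P : Measure (∀ v, X v)) : Prop :=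
  ∃ (μ : ∀ v, Measure (X v)) (f : V → (∀ v, X v) → ℝ≥0∞),
    (∀ v, SigmaFinite (μ v)) ∧
    (∀ v, Measurable (f v)) ∧
    (∀ v, DependsOn (f v) {w | G.Adj w v ∨ w = v}) ∧
    (∀ v x, ∫⁻ t, f v (Function.update x v t) ∂(μ v) = 1) ∧
    P = (Measure.pi μ).withDensity (fun x => ∏ v, f v x)

/-- The marginal distribution over the observed variables. -/
noncomputable def observedMargin {V : Type*} {X : V → Type*} [∀ v, MeasurableSpace (X v)]
    (O : Set V) (P : Measure (∀ v, X v)) : Measure (∀ v : O, X v) :=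
  P.map O.domRestrict

/-- The vector of the variables in `S`, as a function of the observed variables. -/
def vars {V : Type*} {X : V → Type*} {O S : Set V} (h : S ⊆ O) (x : ∀ v : O, X v) :
    ∀ v : S, X v :=
  fun v => x ⟨v, h v.2⟩

theorem measurable_vars {V : Type*} {X : V → Type*} [∀ v, MeasurableSpace (X v)]
    {O S : Set V} (h : S ⊆ O) : Measurable (vars (X := X) h) :=
  measurable_pi_lambda _ fun v => measurable_pi_apply (⟨v, h v.2⟩ : O)

/-- The event that the variables in `S` take the value `s`. -/
def event {V : Type*} {X : V → Type*} {O S : Set V} (h : S ⊆ O) (s : ∀ v : S, X v) :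
    Set (∀ v : O, X v) :=
  {x | vars h x = s}

end ESep

/-!
Intervene on `D`: substitute the value `d` for the parents in `D` in every conditional density. The
resulting law factorizes over the graph without the edges out of `D`. It agrees with `P` on the
event `X_D = d`, and also on all events about non-descendants of `D`, whose densities are unchanged.
An active walk from `A` to `B` in the cut graph cannot pass through `D`, so e-separation yields
d-separation there. Among the ancestors of `A ∪ B ∪ C`, the vertices that can be reached from `A`
along active walks are then separated by `C` from the others in the moral graph, so that the density
splits into two factors, which is the conditional independence.
-/

namespace ESep

section Graph

variable {V : Type*} {G : Digraph V} {A B C D S : Set V} {a b u v w : V} {s : Bool}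

theorem IsAcyclic.asymm (hG : IsAcyclic G) (h : G.Adj u v) : ¬ G.Adj v u :=
  fun h' => hG u (.tail (.single h) h')

theorem IsAcyclic.toSimpleGraphInclusive_adj (hG : IsAcyclic G) (h : G.Adj u v) :
    G.toSimpleGraphInclusive.Adj u v :=
  ⟨fun huv => hG u (.single (huv ▸ h)), .inl h⟩

/-- The vertices with a descendant in `S`. -/
def ancestors (G : Digraph V) (S : Set V) : Set V :=
  {v | ∃ s ∈ S, IsAncestor G v s}

theorem subset_ancestors (G : Digraph V) (S : Set V) : S ⊆ ancestors G S :=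
  fun v hv => ⟨v, hv, .refl⟩

theorem mem_ancestors_of_isAncestor (huv : IsAncestor G u v) (hv : v ∈ ancestors G S) :
    u ∈ ancestors G S :=
  let ⟨s, hs, hvs⟩ := hv
  ⟨s, hs, huv.trans hvs⟩

theorem mem_ancestors_of_adj (huv : G.Adj u v) (hv : v ∈ ancestors G S) : u ∈ ancestors G S :=
  mem_ancestors_of_isAncestor (.single huv) hv

/-- A path running through `u`, `v`, `w` is not blocked by `C` at its internal vertex `v`. -/
def Passable (G : Digraph V) (C : Set V) (u v w : V) : Prop :=
  (G.Adj u v ∧ G.Adj w v → v ∈ ancestors G C) ∧ (¬ (G.Adj u v ∧ G.Adj w v) → v ∉ C)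

theorem not_isBlocked_iff {p : G.toSimpleGraphInclusive.Walk a b} :
    ¬ IsBlocked G C p ↔
      ∀ i, i + 1 < p.length →
        Passable G C (p.getVert i) (p.getVert (i + 1)) (p.getVert (i + 2)) := by
  simp only [IsBlocked, not_exists, not_and, not_or, not_not, not_forall]
  refine ⟨fun h i hi => ⟨fun hcol => ?_, fun hcol hC => ?_⟩, fun h i hi hip => ?_⟩
  · obtain ⟨c, hc, hic⟩ := (h (i + 1) i.succ_pos hi).2 hcol
    exact ⟨c, hc, hic⟩
  · exact (h (i + 1) i.succ_pos hi).1 hcol hC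
  · obtain ⟨i, rfl⟩ := Nat.exists_eq_add_of_lt hi
    simp only [zero_add] at hip ⊢
    refine ⟨(h i hip).2, fun hcol => ?_⟩
    obtain ⟨c, hc, hic⟩ := (h i hip).1 hcol
    exact ⟨c, hc, hic⟩

theorem not_isBlocked_nil : ¬ IsBlocked G C (.nil : G.toSimpleGraphInclusive.Walk a a) :=
  not_isBlocked_iff.2 fun _ hi => absurd hi (Nat.not_lt_zero _)

theorem not_isBlocked_cons_iff {h : G.toSimpleGraphInclusive.Adj u v}
    {p : G.toSimpleGraphInclusive.Walk v w} :
    ¬ IsBlocked G C (.cons h p) ↔ (¬ p.Nil → Passable G C u v p.snd) ∧ ¬ IsBlocked G C p := by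
  rw [not_isBlocked_iff, not_isBlocked_iff, ← Nat.and_forall_add_one]
  simp [SimpleGraph.Walk.not_nil_iff_lt_length, SimpleGraph.Walk.snd]

theorem not_isBlocked_append_iff {p : G.toSimpleGraphInclusive.Walk a v}
    {q : G.toSimpleGraphInclusive.Walk v b} :
    ¬ IsBlocked G C (p.append q) ↔ ¬ IsBlocked G C p ∧ ¬ IsBlocked G C q ∧
      (¬ p.Nil → ¬ q.Nil → Passable G C p.penultimate v q.snd) := by
  induction p with
  | nil => simp [not_isBlocked_nil]
  | cons h p ih =>
    rw [SimpleGraph.Walk.cons_append, not_isBlocked_cons_iff, not_isBlocked_cons_iff, ih]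
    cases p with
    | nil =>
      simp only [not_isBlocked_nil, SimpleGraph.Walk.nil_append, SimpleGraph.Walk.nil_nil,
        SimpleGraph.Walk.not_nil_cons, SimpleGraph.Walk.penultimate_cons_nil]
      tauto
    | cons h' p =>
      simp only [SimpleGraph.Walk.cons_append, SimpleGraph.Walk.not_nil_cons,
        SimpleGraph.Walk.snd_cons, SimpleGraph.Walk.penultimate_cons_cons]
      tauto

theorem not_isBlocked_concat_iff {p : G.toSimpleGraphInclusive.Walk a v}
    {h : G.toSimpleGraphInclusive.Adj v w} :
    ¬ IsBlocked G C (p.concat h) ↔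
      ¬ IsBlocked G C p ∧ (¬ p.Nil → Passable G C p.penultimate v w) := by
  simp [SimpleGraph.Walk.concat_eq_append, not_isBlocked_append_iff, not_isBlocked_cons_iff,
    not_isBlocked_nil]

/-- The walk follows the direction of the edges until it meets a collider, which is a descendant
of `u`. -/
theorem mem_ancestors_or_adj_penultimate {p : G.toSimpleGraphInclusive.Walk u v} (hp : ¬ p.Nil)
    (hact : ¬ IsBlocked G C p) (h : G.Adj u p.snd) :
    u ∈ ancestors G C ∨ G.Adj p.penultimate v := by
  induction p with
  | nil => simp at hp
  | cons e p ih =>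
    by_cases hnil : p.Nil
    · cases hnil
      exact .inr h
    rw [SimpleGraph.Walk.penultimate_cons_of_not_nil _ _ hnil]
    rw [SimpleGraph.Walk.snd_cons] at h
    obtain ⟨hpass, hact⟩ := not_isBlocked_cons_iff.1 hact
    rcases (p.adj_snd hnil).2 with hout | hin
    · exact (ih hnil hact hout).imp_left (mem_ancestors_of_adj h)
    · exact .inl (mem_ancestors_of_adj h ((hpass hnil).1 ⟨h, hin⟩))

/-- If `u` is a collider of the shortened walk, then it is a collider at one of the two ends of the
loop, unless the loop both starts and ends with edges leaving `u`; but such a loop contains a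
collider that is a descendant of `u`. -/
theorem not_isBlocked_append_of_loop {q : G.toSimpleGraphInclusive.Walk a u}
    {r : G.toSimpleGraphInclusive.Walk u u} {t : G.toSimpleGraphInclusive.Walk u b}
    (hr : ¬ r.Nil) (hact : ¬ IsBlocked G C (q.append (r.append t))) :
    ¬ IsBlocked G C (q.append t) := by
  simp only [not_isBlocked_append_iff, SimpleGraph.Walk.nil_append_iff, hr, false_and,
    not_false_eq_true, true_imp_iff] at hact ⊢
  obtain ⟨hq, ⟨hr_act, ht, hrt⟩, hqr⟩ := hact
  refine ⟨hq, ht, fun hqn htn => ?_⟩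
  have hqr := hqr hqn
  have hrt := hrt htn
  have hsnd : (r.append t).snd = r.snd := by
    cases r with
    | nil => simp at hr
    | cons e r => simp
  rw [hsnd] at hqr
  refine ⟨fun ⟨hqu, htu⟩ => ?_, fun hcol hC => ?_⟩
  · rcases (r.adj_snd hr).2 with hout | hin
    · rcases mem_ancestors_or_adj_penultimate hr hr_act hout with hu | hru
      · exact hu
      · exact hrt.1 ⟨hru, htu⟩
    · exact hqr.1 ⟨hqu, hin⟩
  · have hq_in : G.Adj q.penultimate u := by
      by_contra h
      exact hqr.2 (fun h' => h h'.1) hC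
    have ht_in : G.Adj t.snd u := by
      by_contra h
      exact hrt.2 (fun h' => h h'.2) hC
    exact hcol ⟨hq_in, ht_in⟩

theorem exists_append_of_not_isPath {H : SimpleGraph V} {p : H.Walk a b} (hp : ¬ p.IsPath) :
    ∃ (u : V) (q : H.Walk a u) (r : H.Walk u u) (t : H.Walk u b),
      ¬ r.Nil ∧ p = q.append (r.append t) := by
  classical
  induction p with
  | nil => simp at hp
  | cons e p ih =>
    by_cases hpath : p.IsPath
    · have hmem := not_not.1 fun h => hp (SimpleGraph.Walk.cons_isPath_iff e p |>.2 ⟨hpath, h⟩)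
      exact ⟨_, .nil, .cons e (p.takeUntil _ hmem), p.dropUntil _ hmem, by simp, by simp⟩
    · obtain ⟨u, q, r, t, hr, rfl⟩ := ih hpath
      exact ⟨u, .cons e q, r, t, hr, rfl⟩

theorem exists_isPath_not_isBlocked (p : G.toSimpleGraphInclusive.Walk a b)
    (hact : ¬ IsBlocked G C p) :
    ∃ q : G.toSimpleGraphInclusive.Walk a b, q.IsPath ∧ ¬ IsBlocked G C q := by
  induction hn : p.length using Nat.strong_induction_on generalizing p with
  | _ n ih =>
    by_cases hp : p.IsPath
    · exact ⟨p, hp, hact⟩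
    obtain ⟨u, q, r, t, hr, rfl⟩ := exists_append_of_not_isPath hp
    refine ih (q.append t).length ?_ _ (not_isBlocked_append_of_loop hr hact) rfl
    have := SimpleGraph.Walk.not_nil_iff_lt_length.1 hr
    simp only [SimpleGraph.Walk.length_append] at hn ⊢
    omega

/-- `DReachable G A C v s` states that `v` can be reached from `A` along a walk that is not
blocked by `C`. The flag `s` records how the walk arrives: its last edge points to `v` if
`s = true`, whereas for `s = false` the walk is trivial or its last edge points away from `v`. -/
inductive DReachable (G : Digraph V) (A C : Set V) : V → Bool → Prop
  | start {a : V} : a ∈ A → DReachable G A C a false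
  | out {u w : V} {s : Bool} : DReachable G A C u s → u ∉ C → G.Adj u w → DReachable G A C w true
  | back {u w : V} : DReachable G A C u false → u ∉ C → G.Adj w u → DReachable G A C w false
  | collide {u w : V} : DReachable G A C u true → u ∈ ancestors G C → G.Adj w u →
      DReachable G A C w false

namespace DReachable

theorem exists_walk (hG : IsAcyclic G) (hv : DReachable G A C v s) :
    ∃ a ∈ A, ∃ p : G.toSimpleGraphInclusive.Walk a v, ¬ IsBlocked G C p ∧
      (¬ p.Nil → if s then G.Adj p.penultimate v else G.Adj v p.penultimate) := by
  induction hv with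
  | start ha => exact ⟨_, ha, .nil, not_isBlocked_nil, by simp⟩
  | out _ huC huw ih =>
    obtain ⟨a, ha, p, hp, -⟩ := ih
    refine ⟨a, ha, p.concat (hG.toSimpleGraphInclusive_adj huw), not_isBlocked_concat_iff.2
      ⟨hp, fun _ => ⟨fun hcol => ?_, fun _ => huC⟩⟩, fun _ => by simpa using huw⟩
    exact absurd hcol.2 (hG.asymm huw)
  | back _ huC hwu ih =>
    obtain ⟨a, ha, p, hp, hlast⟩ := ih
    refine ⟨a, ha, p.concat (hG.toSimpleGraphInclusive_adj hwu).symm, not_isBlocked_concat_iff.2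
      ⟨hp, fun hnil => ⟨fun hcol => ?_, fun _ => huC⟩⟩, fun _ => by simpa using hwu⟩
    exact absurd hcol.1 (hG.asymm (hlast hnil))
  | collide _ huC hwu ih =>
    obtain ⟨a, ha, p, hp, hlast⟩ := ih
    refine ⟨a, ha, p.concat (hG.toSimpleGraphInclusive_adj hwu).symm, not_isBlocked_concat_iff.2
      ⟨hp, fun hnil => ⟨fun _ => huC, fun hcol => ?_⟩⟩, fun _ => by simpa using hwu⟩
    exact absurd ⟨hlast hnil, hwu⟩ hcol

theorem of_isAncestor (hu : DReachable G A C u s) (hC : u ∉ ancestors G C)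
    (huv : IsAncestor G u v) : ∃ s, DReachable G A C v s := by
  induction huv with
  | refl => exact ⟨s, hu⟩
  | tail huw hwv ih =>
    obtain ⟨s, hs⟩ := ih
    have hwC := fun hw => hC (mem_ancestors_of_isAncestor huw (subset_ancestors G C hw))
    exact ⟨true, hs.out hwC hwv⟩

theorem of_mem_ancestors (hu : u ∈ ancestors G A) (hC : u ∉ ancestors G C) :
    DReachable G A C u false := by
  obtain ⟨a, ha, hua⟩ := hu
  induction hua using Relation.ReflTransGen.head_induction_on with
  | refl => exact .start ha
  | head huw _ ih =>
    have hw := fun hw => hC (mem_ancestors_of_adj huw hw)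
    exact (ih hw).back (fun hwC => hw (subset_ancestors G C hwC)) huw

/-- The case to exclude is a collider at `u` that is not an ancestor of `C`. It is an ancestor of
`A`, so that `u` is also reached against the edges, or of `B`, which would then be reachable. -/
theorem of_adj (hB : ∀ b ∈ B, ∀ s, ¬ DReachable G A C b s) (hu : DReachable G A C u s)
    (hanc : u ∈ ancestors G (A ∪ B ∪ C)) (hC : s = true ∨ u ∉ C) (hwu : G.Adj w u) :
    DReachable G A C w false := by
  cases s with
  | false => exact hu.back (by simpa using hC) hwu
  | true =>
    by_cases huC : u ∈ ancestors G C
    · exact hu.collide huC hwu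
    obtain ⟨x, (hxA | hxB) | hxC, hux⟩ := hanc
    · exact (of_mem_ancestors ⟨x, hxA, hux⟩ huC).back (fun h => huC (subset_ancestors G C h)) hwu
    · obtain ⟨s, hs⟩ := hu.of_isAncestor huC hux
      exact absurd hs (hB x hxB s)
    · exact absurd ⟨x, hxC, hux⟩ huC

end DReachable

theorem DSeparated.not_dReachable (hG : IsAcyclic G) (h : DSeparated G A B C) (hb : b ∈ B)
    (s : Bool) : ¬ DReachable G A C b s := fun hr =>
  let ⟨a, ha, p, hp, _⟩ := hr.exists_walk hG
  let ⟨q, hq, hact⟩ := exists_isPath_not_isBlocked p hp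
  hact (h a ha b hb q hq)

/-- The graph obtained from `G` by deleting all edges that start in `D`. -/
def cutOut (G : Digraph V) (D : Set V) : Digraph V where
  Adj u w := G.Adj u w ∧ u ∉ D

theorem IsAcyclic.cutOut (hG : IsAcyclic G) (D : Set V) : IsAcyclic (cutOut G D) :=
  fun v hv => hG v (Relation.TransGen.mono (fun _ _ h => h.1) _ _ hv)

theorem IsAcyclic.induce (hG : IsAcyclic G) (S : Set V) : IsAcyclic (induce G S) :=
  fun v hv => hG v (Relation.TransGen.lift Subtype.val (fun _ _ h => h) _ _ hv)

theorem mem_ancestors_induce_of_cutOut (hCD : Disjoint C D) (h : u ∈ ancestors (cutOut G D) C) :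
    ∃ hu : u ∉ D, (⟨u, hu⟩ : ↥Dᶜ) ∈ ancestors (induce G Dᶜ) ((↑) ⁻¹' C) := by
  obtain ⟨c, hc, huc⟩ := h
  induction huc using Relation.ReflTransGen.head_induction_on with
  | refl => exact ⟨hCD.notMem_of_mem_left hc, subset_ancestors _ _ hc⟩
  | head huv _ ih =>
    obtain ⟨hv, hvc⟩ := ih
    exact ⟨huv.2, mem_ancestors_of_adj (v := ⟨_, hv⟩) huv.1 hvc⟩

/-- A vertex of `D` has no outgoing edges in `cutOut G D`, so a walk can only end there. -/
theorem DReachable.induce_of_cutOut (hAD : Disjoint A D) (hCD : Disjoint C D)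
    (h : DReachable (cutOut G D) A C v s) :
    (v ∈ D ∧ s = true) ∨
      ∃ hv : v ∉ D, DReachable (induce G Dᶜ) ((↑) ⁻¹' A) ((↑) ⁻¹' C) ⟨v, hv⟩ s := by
  induction h with
  | start ha => exact .inr ⟨hAD.notMem_of_mem_left ha, .start ha⟩
  | @out u w _ _ huC huw ih =>
    by_cases hw : w ∈ D
    · exact .inl ⟨hw, rfl⟩
    · obtain ⟨_, hu⟩ := ih.resolve_left fun h => huw.2 h.1
      exact .inr ⟨hw, hu.out huC huw.1⟩
  | back _ huC hwu ih =>
    obtain ⟨_, hu⟩ := ih.resolve_left (by simp)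
    exact .inr ⟨hwu.2, hu.back huC hwu.1⟩
  | collide _ huC hwu ih =>
    obtain ⟨huD, huC⟩ := mem_ancestors_induce_of_cutOut hCD huC
    obtain ⟨_, hu⟩ := ih.resolve_left fun h => huD h.1
    exact .inr ⟨hwu.2, hu.collide huC hwu.1⟩

theorem ESeparated.not_dReachable_cutOut (hG : IsAcyclic G) (hAD : Disjoint A D)
    (hBD : Disjoint B D) (hCD : Disjoint C D) (h : ESeparated G A B C D) (hb : b ∈ B) (s : Bool) :
    ¬ DReachable (cutOut G D) A C b s := by
  intro hr
  rcases hr.induce_of_cutOut hAD hCD with ⟨hbD, -⟩ | ⟨hbD, hr⟩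
  · exact hBD.notMem_of_mem_left hb hbD
  · exact DSeparated.not_dReachable (hG.induce _) h (b := ⟨b, hbD⟩) hb s hr

/-- The family of a vertex consists of the vertex and its parents. -/
def family (G : Digraph V) (v : V) : Set V :=
  {w | G.Adj w v ∨ w = v}

theorem DReachable.of_mem_family (hB : ∀ b ∈ B, ∀ s, ¬ DReachable G A C b s)
    (hu : DReachable G A C u s) (huC : u ∉ C) (hv : v ∈ ancestors G (A ∪ B ∪ C))
    (huv : u ∈ family G v) (hwv : w ∈ family G v) : ∃ s, DReachable G A C w s := by
  rcases huv, hwv with ⟨huv | rfl, hwv | rfl⟩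
  · exact ⟨_, (hu.out huC huv).of_adj hB hv (.inl rfl) hwv⟩
  · exact ⟨_, hu.out huC huv⟩
  · exact ⟨_, hu.of_adj hB hv (.inr huC) hwv⟩
  · exact ⟨_, hu⟩

/-- Separation in the moral graph: `R` and `S` are separated by `C` in the moral graph of the
subgraph on `C ∪ R ∪ S`, which is closed under taking parents. It is expressed through families
instead of edges, because families are the domains of the factors of the density. -/
structure MorallySeparates [DecidableEq V] (G : Digraph V) (R S C : Finset V) : Prop where
  disjoint : Disjoint R S
  disjoint_left : Disjoint C R
  disjoint_right : Disjoint C S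
  family_subset : ∀ v ∈ C ∪ (R ∪ S), family G v ⊆ ↑(R ∪ C) ∨ family G v ⊆ ↑(S ∪ C)

theorem exists_morallySeparates [Finite V] [DecidableEq V] {C : Finset V}
    (hAC : Disjoint A C) (hBC : Disjoint B C)
    (hB : ∀ b ∈ B, ∀ s, ¬ DReachable G A C b s) :
    ∃ R S : Finset V, MorallySeparates G R S C ∧ A ⊆ R ∧ B ⊆ S := by
  classical
  have := Fintype.ofFinite V
  have hsub := subset_ancestors G (A ∪ B ∪ C)
  let R : Finset V := {v | v ∈ ancestors G (A ∪ B ∪ C) ∧ v ∉ C ∧ ∃ s, DReachable G A C v s}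
  let S : Finset V := {v | v ∈ ancestors G (A ∪ B ∪ C) ∧ v ∉ C ∧ ¬ ∃ s, DReachable G A C v s}
  have hT : ∀ v, v ∈ C ∪ (R ∪ S) ↔ v ∈ ancestors G (A ∪ B ∪ C) := by
    intro v
    have hC : v ∈ C → v ∈ ancestors G (A ∪ B ∪ C) := fun hv => hsub (.inr hv)
    simp only [R, S, Finset.mem_union, Finset.mem_filter_univ]
    tauto
  refine ⟨R, S, ⟨?_, ?_, ?_, fun v hv => ?_⟩, fun a ha => ?_, fun b hb => ?_⟩
  · exact Finset.disjoint_left.2 fun v => by simp only [R, S, Finset.mem_filter_univ]; tauto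
  · exact Finset.disjoint_left.2 fun v => by simp only [R, Finset.mem_filter_univ]; tauto
  · exact Finset.disjoint_left.2 fun v => by simp only [S, Finset.mem_filter_univ]; tauto
  · rw [hT] at hv
    have hfam : ∀ w ∈ family G v, w ∈ C ∪ (R ∪ S) := by
      rintro w (hwv | rfl)
      · exact (hT w).2 (mem_ancestors_of_adj hwv hv)
      · exact (hT w).2 hv
    by_cases hmeets : ∃ u ∈ family G v, u ∈ R
    · obtain ⟨u, huv, huR⟩ := hmeets
      obtain ⟨-, huC, s, hu⟩ := (Finset.mem_filter_univ _).1 huR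
      refine .inl fun w hwv => Finset.mem_coe.2 (Finset.mem_union.2 (or_iff_not_imp_right.2 ?_))
      exact fun hwC => (Finset.mem_filter_univ _).2
        ⟨(hT w).1 (hfam w hwv), hwC, hu.of_mem_family hB huC hv huv hwv⟩
    · refine .inr fun w hwv => ?_
      have hwR : w ∉ R := fun hwR => hmeets ⟨w, hwv, hwR⟩
      have := hfam w hwv
      simp only [Finset.coe_union, Set.mem_union, Finset.mem_coe, Finset.mem_union] at this ⊢
      tauto
  · exact (Finset.mem_filter_univ _).2
      ⟨hsub (.inl (.inl ha)), hAC.notMem_of_mem_left ha, _, .start ha⟩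
  · exact (Finset.mem_filter_univ _).2
      ⟨hsub (.inl (.inr hb)), hBC.notMem_of_mem_left hb, fun ⟨s, hs⟩ => hB b hb s hs⟩

end Graph

section Marginals

variable {V : Type*} {X : V → Type*} {A B : Set V} {R S C : Finset V}

theorem dependsOn_mul {f g : (∀ v, X v) → ℝ≥0∞} (hf : DependsOn f A) (hg : DependsOn g A) :
    DependsOn (f * g) A :=
  fun x y h => by rw [Pi.mul_apply, Pi.mul_apply, hf h, hg h]

theorem dependsOn_prod {ι : Type*} {f : ι → (∀ v, X v) → ℝ≥0∞} {s : Finset ι}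
    (hf : ∀ i ∈ s, DependsOn (f i) A) : DependsOn (∏ i ∈ s, f i) A :=
  fun x y h => by
    simpa only [Finset.prod_apply] using Finset.prod_congr rfl fun i hi => hf i hi h

theorem dependsOn_indicator_one {E : Set (∀ v, X v)} (hE : DependsOn (· ∈ E) A) :
    DependsOn (E.indicator (1 : (∀ v, X v) → ℝ≥0∞)) A := by
  classical
  intro x y h
  have hxy : (x ∈ E) = (y ∈ E) := hE h
  simp only [Set.indicator_apply, hxy, Pi.one_apply]

theorem dependsOn_mem_pi (t : ∀ v, Set (X v)) : DependsOn (· ∈ A.pi t) A :=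
  fun x y h => propext <| forall₂_congr fun v hv => by rw [h v hv]

theorem dependsOn_mem_inter {E F : Set (∀ v, X v)} (hE : DependsOn (· ∈ E) A)
    (hF : DependsOn (· ∈ F) A) : DependsOn (· ∈ E ∩ F) A :=
  fun _ _ h => congr_arg₂ And (hE h) (hF h)

theorem measurable_prod {α ι : Type*} [MeasurableSpace α] {f : ι → α → ℝ≥0∞} {s : Finset ι}
    (hf : ∀ i ∈ s, Measurable (f i)) : Measurable (∏ i ∈ s, f i) := by
  rw [Finset.prod_fn]
  exact s.measurable_fun_prod hf

theorem exists_prod_eq_mul_of_dependsOn [∀ v, MeasurableSpace (X v)] {ι : Type*} {s : Finset ι}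
    {f : ι → (∀ v, X v) → ℝ≥0∞} (hf : ∀ i, Measurable (f i))
    (h : ∀ i ∈ s, DependsOn (f i) A ∨ DependsOn (f i) B) :
    ∃ g h, Measurable g ∧ Measurable h ∧ DependsOn g A ∧ DependsOn h B ∧
      ∏ i ∈ s, f i = g * h := by
  classical
  refine ⟨∏ i ∈ s with DependsOn (f i) A, f i, ∏ i ∈ s with ¬ DependsOn (f i) A, f i,
    measurable_prod fun i _ => hf i, measurable_prod fun i _ => hf i,
    dependsOn_prod fun i hi => (Finset.mem_filter.1 hi).2, dependsOn_prod fun i hi => ?_,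
    (Finset.prod_filter_mul_prod_filter_not s _ f).symm⟩
  exact (h i (Finset.mem_filter.1 hi).1).resolve_left (Finset.mem_filter.1 hi).2

variable [DecidableEq V] [∀ v, MeasurableSpace (X v)] (μ : ∀ v, Measure (X v))
  {f g : (∀ v, X v) → ℝ≥0∞}

theorem dependsOn_lmarginal (hf : DependsOn f A) (S : Finset V) :
    DependsOn (∫⋯∫⁻_S, f ∂μ) (A \ S) :=
  fun _ _ h => lintegral_congr fun z => hf.updateFinset z h

theorem lmarginal_mul_of_dependsOn (hf : DependsOn f A) (hAS : Disjoint A S) (hg : Measurable g) :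
    ∫⋯∫⁻_S, f * g ∂μ = f * ∫⋯∫⁻_S, g ∂μ := by
  ext x
  have hconst : ∀ z, f (Function.updateFinset x S z) = f x := fun z => hf fun v hv => by
    simp [Function.updateFinset, Finset.mem_coe.not.1 (hAS.notMem_of_mem_left hv)]
  simp only [lmarginal, Pi.mul_apply, hconst]
  exact lintegral_const_mul _ (hg.comp measurable_updateFinset)

theorem lmarginal_indicator_pi_singleton_mul {x : ∀ v, X v}
    (hx : ∀ v ∈ C, MeasurableSet {x v}) (hf : DependsOn f C) :
    (∫⋯∫⁻_C, ((C : Set V).pi fun v => {x v}).indicator 1 * f ∂μ) x =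
      (∫⋯∫⁻_C, ((C : Set V).pi fun v => {x v}).indicator 1 ∂μ) x * f x := by
  have hconst : ((C : Set V).pi fun v => {x v}).indicator 1 * f =
      (fun _ => f x) * ((C : Set V).pi fun v => {x v}).indicator 1 := by
    ext y
    by_cases hy : y ∈ (C : Set V).pi fun v => {x v}
    · simp [hy, hf hy]
    · simp [hy]
  rw [hconst, lmarginal_mul_of_dependsOn μ (dependsOn_const _) (Set.empty_disjoint _)
    (measurable_one.indicator (.pi C.countable_toSet hx)), Pi.mul_apply, mul_comm]

variable [∀ v, SigmaFinite (μ v)]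

theorem lmarginal_union_mul_of_dependsOn (hf : Measurable f) (hg : Measurable g)
    (hfR : DependsOn f ↑(R ∪ C)) (hgS : DependsOn g ↑(S ∪ C)) (hRS : Disjoint R S)
    (hCR : Disjoint C R) (hCS : Disjoint C S) :
    ∫⋯∫⁻_(R ∪ S), f * g ∂μ = (∫⋯∫⁻_R, f ∂μ) * ∫⋯∫⁻_S, g ∂μ := by
  have hRCS : Disjoint (↑(R ∪ C) : Set V) S :=
    Finset.disjoint_coe.2 (Finset.disjoint_union_left.2 ⟨hRS, hCS⟩)
  have hgC : DependsOn (∫⋯∫⁻_S, g ∂μ) C := (dependsOn_lmarginal μ hgS S).mono (by simp)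
  rw [lmarginal_union μ _ (hf.mul hg) hRS, lmarginal_mul_of_dependsOn μ hfR hRCS hg, mul_comm,
    lmarginal_mul_of_dependsOn μ hgC (Finset.disjoint_coe.2 hCR) hf, mul_comm]

theorem lmarginal_union_indicator_mul {x : ∀ v, X v} (hx : ∀ v ∈ C, MeasurableSet {x v})
    (hf : Measurable f) (hg : Measurable g)
    (hfR : DependsOn f ↑(R ∪ C)) (hgS : DependsOn g ↑(S ∪ C)) (hRS : Disjoint R S)
    (hCR : Disjoint C R) (hCS : Disjoint C S) :
    (∫⋯∫⁻_(C ∪ (R ∪ S)), ((C : Set V).pi fun v => {x v}).indicator 1 * (f * g) ∂μ) x =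
      (∫⋯∫⁻_C, ((C : Set V).pi fun v => {x v}).indicator 1 ∂μ) x *
        ((∫⋯∫⁻_R, f ∂μ) x * (∫⋯∫⁻_S, g ∂μ) x) := by
  have hZ := (measurable_one (α := ℝ≥0∞)).indicator (MeasurableSet.pi C.countable_toSet hx)
  have hdep : DependsOn ((∫⋯∫⁻_R, f ∂μ) * ∫⋯∫⁻_S, g ∂μ) C :=
    dependsOn_mul ((dependsOn_lmarginal μ hfR R).mono (by simp))
      ((dependsOn_lmarginal μ hgS S).mono (by simp))
  have hC : Disjoint C (R ∪ S) := Finset.disjoint_union_right.2 ⟨hCR, hCS⟩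
  rw [lmarginal_union μ _ (hZ.mul (hf.mul hg)) hC,
    lmarginal_mul_of_dependsOn μ (dependsOn_indicator_one (dependsOn_mem_pi _))
      (Finset.disjoint_coe.2 hC) (hf.mul hg),
    lmarginal_union_mul_of_dependsOn μ hf hg hfR hgS hRS hCR hCS,
    lmarginal_indicator_pi_singleton_mul μ hx hdep, Pi.mul_apply]

end Marginals

section Markov

variable {V : Type*} {X : V → Type*} {G : Digraph V}

theorem IsAcyclic.exists_source [Finite V] (hG : IsAcyclic G) {S : Finset V} (hS : S.Nonempty) :
    ∃ m ∈ S, ∀ u ∈ S, ¬ G.Adj u m := by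
  have : Std.Irrefl (Relation.TransGen G.Adj) := ⟨hG⟩
  obtain ⟨m, hm, hmin⟩ := (Finite.wellFounded_of_trans_of_irrefl
    (Relation.TransGen G.Adj)).has_min (S : Set V) hS
  exact ⟨m, hm, fun u hu hum => hmin u hu (.single hum)⟩

variable [DecidableEq V] [∀ v, MeasurableSpace (X v)]

/-- The functions `f v` are conditional densities of the variables `X v` given their parents, with
respect to the reference measures `μ v`, as in `Factorizes`. -/
structure IsDensityFamily (G : Digraph V) (μ : ∀ v, Measure (X v))
    (f : V → (∀ v, X v) → ℝ≥0∞) : Prop where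
  measurable : ∀ v, Measurable (f v)
  dependsOn : ∀ v, DependsOn (f v) (family G v)
  lintegral_update : ∀ v x, ∫⁻ t, f v (Function.update x v t) ∂(μ v) = 1

/-- The joint law with density `∏ v, f v`. -/
noncomputable def productLaw [Fintype V] (μ : ∀ v, Measure (X v)) (f : V → (∀ v, X v) → ℝ≥0∞) :
    Measure (∀ v, X v) :=
  (Measure.pi μ).withDensity (∏ v, f v)

theorem Factorizes.exists_isDensityFamily [Fintype V] {P : Measure (∀ v, X v)}
    (hP : Factorizes G P) :
    ∃ (μ : ∀ v, Measure (X v)) (f : V → (∀ v, X v) → ℝ≥0∞),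
      (∀ v, SigmaFinite (μ v)) ∧ IsDensityFamily G μ f ∧ P = productLaw μ f := by
  obtain ⟨μ, f, hμ, hfm, hfd, hfi, rfl⟩ := hP
  exact ⟨μ, f, hμ, ⟨hfm, hfd, hfi⟩, by rw [productLaw, Finset.prod_fn]⟩

variable {μ : ∀ v, Measure (X v)} [∀ v, SigmaFinite (μ v)] {f : V → (∀ v, X v) → ℝ≥0∞}

namespace IsDensityFamily

/-- Integrate out the variables in an order opposite to the edges. -/
theorem lmarginal_prod_eq_one [Finite V] (hG : IsAcyclic G) (hf : IsDensityFamily G μ f)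
    (S : Finset V) (hS : ∀ u ∈ S, ∀ v, G.Adj u v → v ∈ S) :
    ∫⋯∫⁻_S, ∏ v ∈ S, f v ∂μ = 1 := by
  induction S using Finset.strongInduction with
  | H S ih =>
    rcases S.eq_empty_or_nonempty with rfl | hne
    · simp
    obtain ⟨m, hm, hsrc⟩ := hG.exists_source hne
    have hfam : Disjoint (family G m) ↑(S.erase m) := by
      refine Set.disjoint_left.2 fun u hu huS => ?_
      obtain ⟨hum, huS⟩ := Finset.mem_erase.1 huS
      exact hu.elim (hsrc u huS) hum
    have hrest := ih _ (Finset.erase_ssubset hm) fun u hu v huv => by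
      rw [Finset.mem_erase] at hu ⊢
      exact ⟨fun h => hsrc u hu.2 (h ▸ huv), hS u hu.2 v huv⟩
    ext x
    rw [lmarginal_erase _ (measurable_prod fun v _ => hf.measurable v) hm,
      ← Finset.mul_prod_erase S f hm, lmarginal_mul_of_dependsOn μ (hf.dependsOn m) hfam
        (measurable_prod fun v _ => hf.measurable v), hrest]
    simpa using hf.lintegral_update m x

variable [Fintype V]

theorem lintegral_productLaw (hG : IsAcyclic G) (hf : IsDensityFamily G μ f) {T : Finset V}
    (hT : ∀ v ∈ T, family G v ⊆ T) {g : (∀ v, X v) → ℝ≥0∞} (hg : Measurable g)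
    (hgT : DependsOn g T) (x : ∀ v, X v) :
    ∫⁻ y, g y ∂(productLaw μ f) = (∫⋯∫⁻_T, g * ∏ v ∈ T, f v ∂μ) x := by
  have hprod (S : Finset V) : Measurable (∏ v ∈ S, f v) :=
    measurable_prod fun v _ => hf.measurable v
  have hdep : DependsOn (g * ∏ v ∈ T, f v) T :=
    dependsOn_mul hgT (dependsOn_prod fun v hv => (hf.dependsOn v).mono (hT v hv))
  have hcompl : ∫⋯∫⁻_Tᶜ, ∏ v ∈ Tᶜ, f v ∂μ = 1 :=
    hf.lmarginal_prod_eq_one hG Tᶜ fun u hu v huv => by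
      rw [Finset.mem_compl] at hu ⊢
      exact fun hv => hu (hT v hv (.inl huv))
  calc ∫⁻ y, g y ∂(productLaw μ f)
    _ = (∫⋯∫⁻_(T ∪ Tᶜ), (g * ∏ v ∈ T, f v) * ∏ v ∈ Tᶜ, f v ∂μ) x := by
      rw [productLaw, lintegral_withDensity_eq_lintegral_mul _ (hprod _) hg,
        lintegral_eq_lmarginal_univ x, Finset.union_compl, mul_assoc, Finset.prod_mul_prod_compl,
        mul_comm]
    _ = (∫⋯∫⁻_T, g * ∏ v ∈ T, f v ∂μ) x := by
      rw [lmarginal_union μ _ ((hg.mul (hprod _)).mul (hprod _)) disjoint_compl_right,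
        lmarginal_mul_of_dependsOn μ hdep (by simpa using disjoint_compl_right) (hprod _), hcompl,
        mul_one]

theorem productLaw_apply (hG : IsAcyclic G) (hf : IsDensityFamily G μ f) {T : Finset V}
    (hT : ∀ v ∈ T, family G v ⊆ T) {E : Set (∀ v, X v)} (hE : MeasurableSet E)
    (hET : DependsOn (· ∈ E) T) (x : ∀ v, X v) :
    productLaw μ f E = (∫⋯∫⁻_T, E.indicator 1 * ∏ v ∈ T, f v ∂μ) x := by
  rw [← hf.lintegral_productLaw hG hT (measurable_one.indicator hE) (dependsOn_indicator_one hET),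
    lintegral_indicator_one hE]

theorem isProbabilityMeasure [Nonempty (∀ v, X v)] (hG : IsAcyclic G)
    (hf : IsDensityFamily G μ f) : IsProbabilityMeasure (productLaw μ f) := by
  obtain ⟨x⟩ := ‹Nonempty (∀ v, X v)›
  have := hf.productLaw_apply hG (T := ∅) (by simp) .univ (fun _ _ _ => rfl) x
  exact ⟨by simpa using this⟩

theorem exists_productLaw_inter_eq_mul (hG : IsAcyclic G) (hf : IsDensityFamily G μ f)
    {R S C : Finset V} (hsep : MorallySeparates G R S C) {x : ∀ v, X v}
    (hx : ∀ v ∈ C, MeasurableSet {x v}) :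
    ∃ Φ Ψ : Set (∀ v, X v) → ℝ≥0∞, ∀ E F : Set (∀ v, X v), MeasurableSet E → MeasurableSet F →
      DependsOn (· ∈ E) R → DependsOn (· ∈ F) S →
      productLaw μ f (((C : Set V).pi fun v => {x v}) ∩ (E ∩ F)) = Φ E * Ψ F := by
  set Z : Set (∀ v, X v) := (C : Set V).pi fun v => {x v}
  obtain ⟨g, h, hg, hh, hgR, hhS, hgh⟩ := exists_prod_eq_mul_of_dependsOn hf.measurable
    (s := C ∪ (R ∪ S)) fun v hv => (hsep.family_subset v hv).imp (hf.dependsOn v).mono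
      (hf.dependsOn v).mono
  refine ⟨fun E => (∫⋯∫⁻_C, Z.indicator 1 ∂μ) x * (∫⋯∫⁻_R, E.indicator 1 * g ∂μ) x,
    fun F => (∫⋯∫⁻_S, F.indicator 1 * h ∂μ) x, fun E F hE hF hER hFS => ?_⟩
  have hZm : MeasurableSet Z := .pi C.countable_toSet hx
  have hmem : DependsOn (· ∈ Z ∩ (E ∩ F)) ↑(C ∪ (R ∪ S)) :=
    dependsOn_mem_inter ((dependsOn_mem_pi _).mono (by simp))
      (dependsOn_mem_inter (hER.mono (by grind)) (hFS.mono (by grind)))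
  calc productLaw μ f (Z ∩ (E ∩ F))
    _ = (∫⋯∫⁻_(C ∪ (R ∪ S)), (Z ∩ (E ∩ F)).indicator 1 * ∏ v ∈ C ∪ (R ∪ S), f v ∂μ) x :=
      hf.productLaw_apply hG (fun v hv => (hsep.family_subset v hv).elim
        (fun h => h.trans (by grind)) fun h => h.trans (by grind)) (hZm.inter (hE.inter hF)) hmem x
    _ = (∫⋯∫⁻_(C ∪ (R ∪ S)), Z.indicator 1 * ((E.indicator 1 * g) * (F.indicator 1 * h)) ∂μ) x := by
      rw [hgh, Set.inter_indicator_one, Set.inter_indicator_one, mul_assoc,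
        mul_mul_mul_comm (E.indicator 1)]
    _ = _ := by
      rw [lmarginal_union_indicator_mul μ hx ((measurable_one.indicator hE).mul hg)
        ((measurable_one.indicator hF).mul hh)
        (dependsOn_mul ((dependsOn_indicator_one hER).mono (by simp)) hgR)
        (dependsOn_mul ((dependsOn_indicator_one hFS).mono (by simp)) hhS)
        hsep.disjoint hsep.disjoint_left hsep.disjoint_right, mul_assoc]

theorem productLaw_inter_mul (hG : IsAcyclic G) (hf : IsDensityFamily G μ f)
    {R S C : Finset V} (hsep : MorallySeparates G R S C) {x : ∀ v, X v}
    (hx : ∀ v ∈ C, MeasurableSet {x v}) {E F : Set (∀ v, X v)} (hE : MeasurableSet E)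
    (hF : MeasurableSet F) (hER : DependsOn (· ∈ E) R) (hFS : DependsOn (· ∈ F) S) :
    productLaw μ f (((C : Set V).pi fun v => {x v}) ∩ (E ∩ F)) *
        productLaw μ f ((C : Set V).pi fun v => {x v}) =
      productLaw μ f (((C : Set V).pi fun v => {x v}) ∩ E) *
        productLaw μ f (((C : Set V).pi fun v => {x v}) ∩ F) := by
  obtain ⟨Φ, Ψ, h⟩ := hf.exists_productLaw_inter_eq_mul hG hsep hx
  have huniv (T : Finset V) : DependsOn (· ∈ (Set.univ : Set (∀ v, X v))) T := fun _ _ _ => rfl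
  have hE' := h E .univ hE .univ hER (huniv S)
  have hF' := h .univ F .univ hF (huniv R) hFS
  have huu := h .univ .univ .univ .univ (huniv R) (huniv S)
  simp only [Set.inter_univ, Set.univ_inter] at hE' hF' huu
  rw [h E F hE hF hER hFS, hE', hF', huu]
  ring

end IsDensityFamily

end Markov

section CondIndep

variable {Ω α β γ : Type*} [MeasurableSpace Ω] {μ : Measure Ω}

theorem cond_inter_eq_of_restrict_eq {ν : Measure Ω} {s t : Set Ω} (hs : MeasurableSet s)
    (ht : MeasurableSet t) (hst : μ s = ν s) (hrestrict : μ.restrict t = ν.restrict t)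
    (E : Set Ω) : μ[E ∩ t | s] = ν[E ∩ t | s] := by
  rw [cond_apply hs, cond_apply hs, hst, ← Set.inter_assoc, ← Measure.restrict_apply' ht,
    ← Measure.restrict_apply' ht, hrestrict]

variable [MeasurableSpace γ] [MeasurableSingletonClass γ] [IsFiniteMeasure μ] {Z : Ω → γ}

theorem condExp_indicator_mul_measureReal (hZ : Measurable Z) {E : Set Ω} (hE : MeasurableSet E)
    (ω : Ω) :
    (μ⟦E | MeasurableSpace.comap Z inferInstance⟧) ω * μ.real (Z ⁻¹' {Z ω}) =
      μ.real (Z ⁻¹' {Z ω} ∩ E) := by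
  have hatom : MeasurableSet[MeasurableSpace.comap Z inferInstance] (Z ⁻¹' {Z ω}) :=
    ⟨_, measurableSet_singleton _, rfl⟩
  have hconst : (μ⟦E | MeasurableSpace.comap Z inferInstance⟧).FactorsThrough Z :=
    stronglyMeasurable_condExp.factorsThrough
  have hint := setIntegral_condExp hZ.comap_le ((integrable_const (1 : ℝ)).indicator hE) hatom
    (μ := μ)
  rw [setIntegral_congr_fun (hZ (measurableSet_singleton _)) (fun y hy => hconst hy),
    setIntegral_const, setIntegral_indicator hE, setIntegral_const] at hint
  simpa [mul_comm] using hint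

theorem condIndepFun_of_measure_inter_mul [StandardBorelSpace Ω] [MeasurableSpace α]
    [MeasurableSpace β] [Countable γ] {f : Ω → α} {g : Ω → β} (hf : Measurable f)
    (hg : Measurable g) (hZ : Measurable Z)
    (h : ∀ s t z, MeasurableSet s → MeasurableSet t →
      μ (Z ⁻¹' {z} ∩ (f ⁻¹' s ∩ g ⁻¹' t)) * μ (Z ⁻¹' {z}) =
        μ (Z ⁻¹' {z} ∩ f ⁻¹' s) * μ (Z ⁻¹' {z} ∩ g ⁻¹' t)) :
    f ⟂ᵢ[Z, hZ; μ] g := by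
  rw [condIndepFun_iff_condExp_inter_preimage_eq_mul hf hg]
  intro s t hs ht
  have hatom : ∀ᵐ ω ∂μ, μ.real (Z ⁻¹' {Z ω}) ≠ 0 := by
    have hnull : μ (⋃ z ∈ {z | μ (Z ⁻¹' {z}) = 0}, Z ⁻¹' {z}) = 0 :=
      (measure_biUnion_null_iff (Set.to_countable _)).2 fun z hz => hz
    rw [ae_iff]
    refine measure_mono_null (fun ω hω => ?_) hnull
    simpa [measureReal_eq_zero_iff] using hω
  filter_upwards [hatom] with ω hω
  have hmul : μ.real (Z ⁻¹' {Z ω} ∩ (f ⁻¹' s ∩ g ⁻¹' t)) * μ.real (Z ⁻¹' {Z ω}) =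
      μ.real (Z ⁻¹' {Z ω} ∩ f ⁻¹' s) * μ.real (Z ⁻¹' {Z ω} ∩ g ⁻¹' t) := by
    simpa only [measureReal_def, ENNReal.toReal_mul] using
      congrArg ENNReal.toReal (h s t (Z ω) hs ht)
  rw [← condExp_indicator_mul_measureReal hZ ((hf hs).inter (hg ht)),
    ← condExp_indicator_mul_measureReal hZ (hf hs),
    ← condExp_indicator_mul_measureReal hZ (hg ht)] at hmul
  refine mul_right_cancel₀ hω (mul_right_cancel₀ hω (hmul.trans ?_))
  ring

end CondIndep

section Intervention

variable {V : Type*} {X : V → Type*} {G : Digraph V} {D : Set V} {x₀ : ∀ v, X v}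

/-- The vertices that are not descendants of a vertex in `D`. -/
def nonDescendants (G : Digraph V) (D : Set V) : Set V :=
  {v | ∀ u ∈ D, ¬ IsAncestor G u v}

theorem disjoint_nonDescendants (G : Digraph V) (D : Set V) : Disjoint (nonDescendants G D) D :=
  Set.disjoint_left.2 fun v hv hvD => hv v hvD .refl

theorem family_subset_nonDescendants {v : V} (hv : v ∈ nonDescendants G D) :
    family G v ⊆ nonDescendants G D := by
  rintro w (hwv | rfl)
  · exact fun u hu huw => hv u hu (huw.tail hwv)
  · exact hv

theorem piecewise_update_of_notMem [DecidableEq V] {S : Set V} {_ : ∀ w, Decidable (w ∈ S)} {v : V}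
    (hv : v ∉ S) (x y : ∀ v, X v) (t : X v) :
    S.piecewise x (Function.update y v t) = Function.update (S.piecewise x y) v t := by
  ext w
  by_cases hw : w = v
  · subst hw
    simp [hv]
  · by_cases hwS : w ∈ S <;> simp [hw, hwS]

open Classical in
/-- The conditional densities after the intervention that fixes the variables in `D` to their
values in `x₀`: these are substituted into the density of `X v` wherever a parent in `D` occurs, but
not for the variable `X v` itself, so that the result is again a family of conditional densities. -/
noncomputable def intervene (D : Set V) (x₀ : ∀ v, X v) (f : V → (∀ v, X v) → ℝ≥0∞) (v : V)
    (x : ∀ v, X v) : ℝ≥0∞ :=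
  f v ((D \ {v}).piecewise x₀ x)

variable {f : V → (∀ v, X v) → ℝ≥0∞}

theorem intervene_of_forall_eq {x : ∀ v, X v} (hx : ∀ v ∈ D, x v = x₀ v) (v : V) :
    intervene D x₀ f v x = f v x := by
  refine congrArg (f v) (funext fun w => ?_)
  by_cases hw : w ∈ D \ {v}
  · exact (if_pos hw).trans (hx w hw.1).symm
  · exact if_neg hw

theorem intervene_of_disjoint {A : Set V} {v : V} (hf : DependsOn (f v) A) (hA : Disjoint A D) :
    intervene D x₀ f v = f v :=
  funext fun _ => hf fun _ hw => if_neg fun h => hA.notMem_of_mem_left hw h.1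

variable [∀ v, MeasurableSpace (X v)] {μ : ∀ v, Measure (X v)}

theorem restrict_productLaw_intervene [Fintype V] {E : Set (∀ v, X v)} (hE : MeasurableSet E)
    (hED : ∀ x ∈ E, ∀ v ∈ D, x v = x₀ v) :
    (productLaw μ (intervene D x₀ f)).restrict E = (productLaw μ f).restrict E := by
  rw [productLaw, productLaw, restrict_withDensity hE, restrict_withDensity hE]
  refine withDensity_congr_ae (ae_restrict_of_forall_mem hE fun x hx => ?_)
  simp only [Finset.prod_apply, intervene_of_forall_eq (hED x hx)]

variable [DecidableEq V]

namespace IsDensityFamily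

theorem intervene (hf : IsDensityFamily G μ f) (D : Set V) (x₀ : ∀ v, X v) :
    IsDensityFamily (cutOut G D) μ (intervene D x₀ f) where
  measurable v := by
    refine (hf.measurable v).comp (measurable_pi_lambda _ fun w => ?_)
    by_cases hw : w ∈ D \ {v} <;> simp only [Set.piecewise, hw, if_true, if_false]
    · exact measurable_const
    · exact measurable_pi_apply w
  dependsOn v x y h := by
    refine hf.dependsOn v fun w hw => ?_
    by_cases hwD : w ∈ D \ {v} <;> simp only [Set.piecewise, hwD, if_true, if_false]
    refine h w (or_iff_not_imp_right.2 fun hwv => ?_)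
    exact ⟨hw.resolve_right hwv, fun h => hwD ⟨h, hwv⟩⟩
  lintegral_update v x := (lintegral_congr fun t => congrArg (f v)
    (piecewise_update_of_notMem (fun h => h.2 rfl) x₀ x t)).trans (hf.lintegral_update v _)

theorem productLaw_intervene_of_dependsOn [Fintype V] [∀ v, SigmaFinite (μ v)]
    (hG : IsAcyclic G) (hf : IsDensityFamily G μ f) {E : Set (∀ v, X v)} (hE : MeasurableSet E)
    (hED : DependsOn (· ∈ E) (nonDescendants G D)) (x₀ : ∀ v, X v) :
    productLaw μ (ESep.intervene D x₀ f) E = productLaw μ f E := by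
  classical
  lift nonDescendants G D to Finset V using Set.toFinite _ with T hT
  have hfam : ∀ v ∈ T, family G v ⊆ T := fun v hv => by
    rw [← Finset.mem_coe, hT] at hv
    exact hT ▸ family_subset_nonDescendants hv
  rw [hf.productLaw_apply hG hfam hE hED x₀, (hf.intervene D x₀).productLaw_apply (hG.cutOut D)
    (fun v hv w hw => hfam v hv (hw.imp_left And.left)) hE hED x₀]
  have hprod : ∏ v ∈ T, ESep.intervene D x₀ f v = ∏ v ∈ T, f v :=
    Finset.prod_congr rfl fun v hv => intervene_of_disjoint (hf.dependsOn v)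
      ((hT ▸ disjoint_nonDescendants G D).mono_left (hfam v hv))
  rw [hprod]

end IsDensityFamily

end Intervention

section Observed

variable {V : Type*} {X : V → Type*} {O : Set V}

theorem dependsOn_mem_vars_preimage {S : Set V} (h : S ⊆ O) (s : Set (∀ v : S, X v)) :
    DependsOn (· ∈ vars h ⁻¹' s) ((↑) ⁻¹' S : Set O) := by
  intro x y hxy
  have : vars h x = vars h y := funext fun v => hxy _ v.2
  simp only [Set.mem_preimage, this]

theorem dependsOn_mem_event {S T : Set V} (h : S ⊆ O) (s : ∀ v : S, X v) (hST : S ⊆ T) :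
    DependsOn (· ∈ event h s) ((↑) ⁻¹' T : Set O) :=
  (dependsOn_mem_vars_preimage h {s}).mono (Set.preimage_mono hST)

theorem dependsOn_mem_domRestrict_preimage {S : Set V} {E : Set (∀ v : O, X v)}
    (hE : DependsOn (· ∈ E) ((↑) ⁻¹' S : Set O)) : DependsOn (· ∈ O.domRestrict ⁻¹' E) S :=
  fun _ _ hxy => hE fun v hv => hxy v hv

theorem domRestrict_preimage_vars_singleton {S : Set V} (h : S ⊆ O) (x : ∀ v, X v) :
    O.domRestrict ⁻¹' (vars h ⁻¹' {S.domRestrict x}) = S.pi fun v => {x v} := by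
  ext y
  simp [vars, funext_iff]

variable [∀ v, MeasurableSpace (X v)]

theorem observedMargin_apply (P : Measure (∀ v, X v)) {E : Set (∀ v : O, X v)}
    (hE : MeasurableSet E) : observedMargin O P E = P (O.domRestrict ⁻¹' E) :=
  Measure.map_apply (O.measurable_restrict) hE

theorem measurableSingletonClass_pi_of_subset [Finite V] [∀ v : O, MeasurableSingletonClass (X v)]
    {S : Set V} (h : S ⊆ O) : MeasurableSingletonClass (∀ v : S, X v) :=
  have (v : S) : MeasurableSingletonClass (X v) :=
    ‹∀ v : O, MeasurableSingletonClass (X v)› ⟨v, h v.2⟩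
  inferInstance

variable [Fintype V] [DecidableEq V] [∀ v : O, StandardBorelSpace (X v)] {A B C D : Set V}
  {G : Digraph V} {μ : ∀ v, Measure (X v)} [∀ v, SigmaFinite (μ v)] {f : V → (∀ v, X v) → ℝ≥0∞}

namespace IsDensityFamily

/-- The global Markov property. -/
theorem condIndepFun_vars [Nonempty (∀ v, X v)] [∀ v : C, Countable (X v)] (hG : IsAcyclic G)
    (hf : IsDensityFamily G μ f) (hA : A ⊆ O) (hB : B ⊆ O) (hC : C ⊆ O) (hAC : Disjoint A C)
    (hBC : Disjoint B C) (hsep : ∀ b ∈ B, ∀ s, ¬ DReachable G A C b s)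
    [IsFiniteMeasure (observedMargin O (productLaw μ f))] :
    vars hA ⟂ᵢ[vars hC, measurable_vars hC; observedMargin O (productLaw μ f)] vars hB := by
  have := measurableSingletonClass_pi_of_subset (X := X) hC
  refine condIndepFun_of_measure_inter_mul (measurable_vars hA) (measurable_vars hB)
    (measurable_vars hC) fun s t z hs ht => ?_
  have : ∀ v, Nonempty (X v) := Classical.nonempty_pi.1 inferInstance
  obtain ⟨x, rfl : C.domRestrict x = z⟩ := Subtype.exists_pi_extension z
  lift C to Finset V using C.toFinite
  obtain ⟨R, S, hRSC, hAR, hBS⟩ := exists_morallySeparates hAC hBC hsep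
  have hx : ∀ v ∈ C, MeasurableSet {x v} := fun v hv =>
    measurableSet_singleton (α := X (⟨v, hC hv⟩ : O)) _
  have hs' := measurable_vars hA hs
  have ht' := measurable_vars hB ht
  have hz := measurable_vars hC (measurableSet_singleton ((C : Set V).domRestrict x))
  rw [observedMargin_apply _ hz, observedMargin_apply _ (hz.inter (hs'.inter ht')),
    observedMargin_apply _ (hz.inter hs'), observedMargin_apply _ (hz.inter ht')]
  simp only [Set.preimage_inter, domRestrict_preimage_vars_singleton]
  have hER := (dependsOn_mem_domRestrict_preimage (dependsOn_mem_vars_preimage hA s)).mono hAR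
  have hFS := (dependsOn_mem_domRestrict_preimage (dependsOn_mem_vars_preimage hB t)).mono hBS
  exact hf.productLaw_inter_mul hG hRSC hx (O.measurable_restrict hs')
    (O.measurable_restrict ht') hER hFS

end IsDensityFamily

end Observed

end ESep

/-- Part 1 of `theorem1` is the case `Z = event hC c`, part 2 is `Z = event hA a ∩ event hC c`. -/
theorem theorem1_general {V : Type*} [Fintype V] [DecidableEq V] (G : Digraph V)
    (hG : ESep.IsAcyclic G) (O : Set V) {X : V → Type*} [∀ v, MeasurableSpace (X v)]
    [∀ v : O, StandardBorelSpace (X v)] (P : Measure (∀ v, X v)) [IsProbabilityMeasure P]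
    (hP : ESep.Factorizes G P) (A B C D : Set V) (hA : A ⊆ O) (hB : B ⊆ O) (hC : C ⊆ O) (hD : D ⊆ O)
    [∀ v : C, Countable (X v)] (hAC : Disjoint A C) (hAD : Disjoint A D) (hBC : Disjoint B C)
    (hBD : Disjoint B D) (hCD : Disjoint C D) (hsep : ESep.ESeparated G A B C D)
    (d : ∀ v : D, X v) :
    ∃ (Pstar : Measure (∀ v : O, X v)) (_ : IsProbabilityMeasure Pstar),
      (ESep.vars hA ⟂ᵢ[ESep.vars hC, ESep.measurable_vars hC; Pstar] ESep.vars hB) ∧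
      ∀ Z, MeasurableSet Z → DependsOn (· ∈ Z) ((↑) ⁻¹' ESep.nonDescendants G D : Set O) →
        Pstar Z = ESep.observedMargin O P Z ∧
        ∀ E, Pstar[E ∩ ESep.event hD d | Z] =
          (ESep.observedMargin O P)[E ∩ ESep.event hD d | Z] := by
  obtain ⟨μ, f, _, hf, rfl⟩ := hP.exists_isDensityFamily
  have hne := nonempty_of_isProbabilityMeasure (ESep.productLaw μ f)
  have : ∀ v, Nonempty (X v) := Classical.nonempty_pi.1 hne
  obtain ⟨x₀, rfl : D.domRestrict x₀ = d⟩ := Subtype.exists_pi_extension d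
  have hf' := hf.intervene D x₀
  have := hf'.isProbabilityMeasure (hG.cutOut D)
  have : IsProbabilityMeasure (ESep.observedMargin O (ESep.productLaw μ (ESep.intervene D x₀ f))) :=
    Measure.isProbabilityMeasure_map O.measurable_restrict.aemeasurable
  have := ESep.measurableSingletonClass_pi_of_subset (X := X) hD
  have hevent : MeasurableSet (ESep.event hD (D.domRestrict x₀)) :=
    ESep.measurable_vars hD (measurableSet_singleton _)
  refine ⟨_, inferInstance, hf'.condIndepFun_vars (hG.cutOut D) hA hB hC hAC hBC fun b hb =>
    hsep.not_dReachable_cutOut hG hAD hBD hCD hb, fun Z hZ hZD => ?_⟩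
  have hagree : ESep.observedMargin O (ESep.productLaw μ (ESep.intervene D x₀ f)) Z =
      ESep.observedMargin O (ESep.productLaw μ f) Z := by
    rw [ESep.observedMargin_apply _ hZ, ESep.observedMargin_apply _ hZ]
    exact hf.productLaw_intervene_of_dependsOn hG (O.measurable_restrict hZ)
      (ESep.dependsOn_mem_domRestrict_preimage hZD) x₀
  refine ⟨hagree, ESep.cond_inter_eq_of_restrict_eq hZ hevent hagree ?_⟩
  rw [ESep.observedMargin, ESep.observedMargin, Measure.restrict_map O.measurable_restrict hevent,
    Measure.restrict_map O.measurable_restrict hevent, ESep.restrict_productLaw_intervene]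
  · exact O.measurable_restrict hevent
  · exact fun x hx v hv => congrFun hx ⟨v, hv⟩

theorem theorem1 {V : Type*} [Fintype V] [DecidableEq V]
    (G : Digraph V) (hG : ESep.IsAcyclic G)
    (O : Set V) {X : V → Type*} [∀ v, MeasurableSpace (X v)]
    [∀ v : O, Countable (X v)] [∀ v : O, MeasurableSingletonClass (X v)]
    (P : Measure (∀ v, X v)) [IsProbabilityMeasure P] (hP : ESep.Factorizes G P)
    (A B C D : Set V) (hA : A ⊆ O) (hB : B ⊆ O) (hC : C ⊆ O) (hD : D ⊆ O)
    (hAB : Disjoint A B) (hAC : Disjoint A C) (hAD : Disjoint A D)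
    (hBC : Disjoint B C) (hBD : Disjoint B D) (hCD : Disjoint C D)
    (hDC : ∀ u ∈ D, ∀ c ∈ C, ¬ ESep.IsAncestor G u c)
    (hsep : ESep.ESeparated G A B C D)
    (d : ∀ v : D, X v) :
    (∃ (Pstar : Measure (∀ v : O, X v)) (_ : IsProbabilityMeasure Pstar),
      (ESep.vars hA ⟂ᵢ[ESep.vars hC, ESep.measurable_vars hC; Pstar] ESep.vars hB) ∧
      ∀ c, ESep.observedMargin O P (ESep.event hC c) ≠ 0 →
        Pstar (ESep.event hC c) ≠ 0 ∧
        ∀ a b,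
          Pstar[ESep.event hA a ∩ ESep.event hB b ∩ ESep.event hD d | ESep.event hC c] =
            (ESep.observedMargin O P)[ESep.event hA a ∩ ESep.event hB b ∩ ESep.event hD d |
              ESep.event hC c]) ∧
    ((∀ u ∈ D, ∀ a ∈ A, ¬ ESep.IsAncestor G u a) →
      ∃ (Pstar : Measure (∀ v : O, X v)) (_ : IsProbabilityMeasure Pstar),
        (ESep.vars hA ⟂ᵢ[ESep.vars hC, ESep.measurable_vars hC; Pstar] ESep.vars hB) ∧
        ∀ a c, ESep.observedMargin O P (ESep.event hA a ∩ ESep.event hC c) ≠ 0 →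
          Pstar (ESep.event hA a ∩ ESep.event hC c) ≠ 0 ∧
          ∀ b,
            Pstar[ESep.event hB b ∩ ESep.event hD d | ESep.event hA a ∩ ESep.event hC c] =
              (ESep.observedMargin O P)[ESep.event hB b ∩ ESep.event hD d |
                ESep.event hA a ∩ ESep.event hC c]) := by
  have : ∀ v : C, Countable (X v) := fun v => ‹∀ v : O, Countable (X v)› ⟨v, hC v.2⟩
  obtain ⟨Pstar, hprob, hindep, hagree⟩ :=
    theorem1_general G hG O P hP A B C D hA hB hC hD hAC hAD hBC hBD hCD hsep d
  have hCD' : C ⊆ ESep.nonDescendants G D := fun c hc u hu => hDC u hu c hc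
  have hagreeC (c) := hagree (ESep.event hC c) .of_discrete (ESep.dependsOn_mem_event hC c hCD')
  refine ⟨⟨Pstar, hprob, hindep, fun c hc => ⟨(hagreeC c).1 ▸ hc, fun a b => (hagreeC c).2 _⟩⟩,
    fun hDA => ⟨Pstar, hprob, hindep, fun a c hac => ?_⟩⟩
  have hAD' : A ⊆ ESep.nonDescendants G D := fun a ha u hu => hDA u hu a ha
  have hagreeAC := hagree (ESep.event hA a ∩ ESep.event hC c) .of_discrete
    (ESep.dependsOn_mem_inter (ESep.dependsOn_mem_event hA a hAD')
      (ESep.dependsOn_mem_event hC c hCD'))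
  exact ⟨hagreeAC.1 ▸ hac, fun b => hagreeAC.2 _⟩
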